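/- Graphs are simple and undirected, of arbitrary cardinality. A ray is a one-way infinite path, i.e. a graph isomorphic to the graph on $\mathbb{N}$ in which $m$ and $n$ are adjacent if and only if $|m-n|=1$; a $2$-ray is a vertex-disjoint union of two rays. A graph $H$ is called edge-ubiquitous if every graph $G$ which, for every $k\in\mathbb{N}$, contains a family of $k$ pairwise edge-disjoint subgraphs each isomorphic to $H$ also contains an infinite family of pairwise edge-disjoint subgraphs each isomorphic to $H$. The $2$-ray is edge-ubiquitous: every graph $G$ that contains, for every $k\in\mathbb{N}$, $k$ pairwise edge-disjoint $2$-rays contains infinitely many pairwise edge-disjoint $2$-rays. -/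

import Mathlib

open SimpleGraph

universe u w

/-- `G` has a family, indexed by `ι`, of pairwise edge-disjoint subgraphs
each of which is isomorphic to `H`. -/
def HasEdgeDisjointFamily {V W : Type*} (ι : Type*) (G : SimpleGraph V) (H : SimpleGraph W) :
    Prop :=
  ∃ S : ι → G.Subgraph,
    (∀ i, Nonempty ((S i).coe ≃g H)) ∧
    ∀ i j, i ≠ j → Disjoint (S i).edgeSet (S j).edgeSet

/-- `G` has arbitrarily many edge-disjoint `H`: for every natural number `k`
there is a family of `k` edge-disjoint subgraphs of `G`, each isomorphic to `H`. -/
def HasArbitrarilyManyEdgeDisjoint {V W : Type*} (G : SimpleGraph V) (H : SimpleGraph W) : Prop :=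
  ∀ k : ℕ, HasEdgeDisjointFamily (Fin k) G H

/-- `G` has infinitely many edge-disjoint `H`: there is an infinite family of
edge-disjoint subgraphs of `G`, each isomorphic to `H`. (If `H` has an edge, the members of
such a family are automatically distinct.) -/
def HasInfinitelyManyEdgeDisjoint {V W : Type*} (G : SimpleGraph V) (H : SimpleGraph W) : Prop :=
  HasEdgeDisjointFamily ℕ G H

/-- `H` is edge-ubiquitous (among graphs whose vertex type lies in the universe `u`): every graph having
arbitrarily many edge-disjoint `H` also has infinitely many edge-disjoint `H`. -/
def IsEdgeUbiquitous {W : Type w} (H : SimpleGraph W) : Prop :=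
  ∀ (V : Type u) (G : SimpleGraph V),
    HasArbitrarilyManyEdgeDisjoint G H → HasInfinitelyManyEdgeDisjoint G H

/-- The ray: the one-way infinite path on the vertices `0, 1, 2, …`, consecutive numbers being
adjacent. -/
def rayGraph : SimpleGraph ℕ := hasse ℕ

/-- The `2`-ray: the vertex-disjoint union of two rays. -/
def twoRayGraph : SimpleGraph (ℕ ⊕ ℕ) := rayGraph ⊕g rayGraph

/-!
A disjoint union `H` of finitely many rays has arbitrarily remote copies inside itself, and so only
countable, locally finite graphs `G` matter: trim the members of the `k`-th edge-disjoint family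
so that they avoid the first `k` vertices.

Let `I` be a maximal set of vertices such that the closed neighbourhoods of the vertices satisfy
Hall's condition after deleting `I`.

* If `I` is infinite, the injection provided by Hall's theorem moves every vertex along an edge or
  fixes it and misses `I`. Its orbits from the vertices of `I` are infinitely many disjoint rays.
* If `I` is finite, every finite vertex set lies in a finite set with at most `|I|` outer boundary
  vertices, so that `G` has an exhaustion by finite sets of bounded boundary. A copy of `H`,
  directed away from its starting vertices, crosses such a boundary in one of boundedly many
  patterns. By pigeonhole there are edge-disjoint families of all finite sizes whose members have
  the same pattern at suitable boundaries. There the members of one family can be continued by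
  those of the next larger one, which leaves room for one new copy of `H` at every stage.

Continuations need not respect the individual rays: the glued edges only have in- and out-degree
at most one and no new sources, which is enough to follow them from the starting vertices. A
union of infinitely many rays contains infinitely many disjoint copies of itself.
-/

section Copies

variable {J V V' W W' : Type*} {G : SimpleGraph V} {G' : SimpleGraph V'} {H : SimpleGraph W}
  {H' : SimpleGraph W'}

/-- The edges of `G` used by a copy of `H` in `G`. -/
def copyEdges (c : Copy H G) : Set (Sym2 V) := Sym2.map c '' H.edgeSet

theorem edgeSet_toSubgraph (c : Copy H G) : c.toSubgraph.edgeSet = copyEdges c := by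
  simp [copyEdges, Subgraph.edgeSet_map]

theorem copyEdges_comp (f : Copy G G') (c : Copy H G) :
    copyEdges (f.comp c) = Sym2.map f '' copyEdges c := by
  rw [copyEdges, Copy.coe_comp, Sym2.map_comp, Set.image_comp, copyEdges]

theorem copyEdges_subset_edgeSet (c : Copy H G) : copyEdges c ⊆ G.edgeSet :=
  edgeSet_toSubgraph c ▸ Subgraph.edgeSet_subset _

theorem copyEdges_comp_subset (c : Copy H G) (d : Copy H' H) :
    copyEdges (c.comp d) ⊆ copyEdges c :=
  copyEdges_comp c d ▸ Set.image_mono (copyEdges_subset_edgeSet d)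

/-- The members of a family of copies of `H` in `G` pairwise share no edge (they may share
vertices). -/
def EdgeDisjointCopies (c : J → Copy H G) : Prop :=
  Pairwise fun i j => Disjoint (copyEdges (c i)) (copyEdges (c j))

theorem EdgeDisjointCopies.mono {c : J → Copy H G} (hc : EdgeDisjointCopies c)
    {d : J → Copy H' G} (hd : ∀ j, copyEdges (d j) ⊆ copyEdges (c j)) : EdgeDisjointCopies d :=
  fun i j hij => (hc hij).mono (hd i) (hd j)

theorem edgeDisjointCopies_comp_iff (f : Copy G G') {c : J → Copy H G} :
    (EdgeDisjointCopies fun j => f.comp (c j)) ↔ EdgeDisjointCopies c := by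
  have hf : Function.Injective f := f.injective
  simp_rw [EdgeDisjointCopies, copyEdges_comp, Set.disjoint_image_iff (Sym2.map.injective hf)]

theorem hasEdgeDisjointFamily_iff_exists_copies :
    HasEdgeDisjointFamily J G H ↔ ∃ c : J → Copy H G, EdgeDisjointCopies c := by
  constructor
  · rintro ⟨S, hS, hdisj⟩
    have hcopy (j : J) : ∃ c : Copy H G, c.toSubgraph = S j := by
      rw [← Set.mem_range, Copy.range_toSubgraph]
      exact (hS j).map (·.symm)
    choose c hc using hcopy
    refine ⟨c, fun i j hij => ?_⟩
    simpa only [← edgeSet_toSubgraph, hc] using hdisj i j hij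
  · rintro ⟨c, hc⟩
    refine ⟨fun j => (c j).toSubgraph, fun j => ⟨(c j).isoToSubgraph.symm⟩, fun i j hij => ?_⟩
    simpa only [edgeSet_toSubgraph] using hc hij

theorem HasEdgeDisjointFamily.of_copy (h : HasEdgeDisjointFamily J G H) (d : Copy H' H) :
    HasEdgeDisjointFamily J G H' := by
  obtain ⟨c, hc⟩ := hasEdgeDisjointFamily_iff_exists_copies.1 h
  exact hasEdgeDisjointFamily_iff_exists_copies.2
    ⟨fun j => (c j).comp d, hc.mono fun j => copyEdges_comp_subset (c j) d⟩

theorem HasEdgeDisjointFamily.map (h : HasEdgeDisjointFamily J G H) (f : Copy G G') :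
    HasEdgeDisjointFamily J G' H := by
  obtain ⟨c, hc⟩ := hasEdgeDisjointFamily_iff_exists_copies.1 h
  exact hasEdgeDisjointFamily_iff_exists_copies.2 ⟨_, (edgeDisjointCopies_comp_iff f).2 hc⟩

theorem IsEdgeUbiquitous.of_iso (h : IsEdgeUbiquitous.{u} H) (e : H ≃g H') :
    IsEdgeUbiquitous.{u} H' := fun V G hG =>
  (h V G fun k => (hG k).of_copy e.toCopy).of_copy e.symm.toCopy

theorem exists_coeCopy_comp_eq {K : G.Subgraph} {c : Copy H G} (hc : c.toSubgraph ≤ K) :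
    ∃ c' : Copy H K.coe, K.coeCopy.comp c' = c :=
  ⟨((Subgraph.inclusion hc).toCopy (Subgraph.inclusion.injective hc)).comp
    c.isoToSubgraph.toCopy, rfl⟩

theorem EdgeDisjointCopies.hasEdgeDisjointFamily_coe {c : J → Copy H G}
    (hc : EdgeDisjointCopies c) {K : G.Subgraph} (hK : ∀ j, (c j).toSubgraph ≤ K) :
    HasEdgeDisjointFamily J K.coe H := by
  choose c' hc' using fun j => exists_coeCopy_comp_eq (hK j)
  refine hasEdgeDisjointFamily_iff_exists_copies.2
    ⟨c', (edgeDisjointCopies_comp_iff K.coeCopy).1 ?_⟩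
  simpa only [hc'] using hc

end Copies

section Reduction

variable {V W : Type*} {G : SimpleGraph V} {H : SimpleGraph W}

theorem verts_toSubgraph (c : Copy H G) : c.toSubgraph.verts = Set.range c := by
  simp

theorem finite_neighborSet_toSubgraph (hH : ∀ w, (H.neighborSet w).Finite) (c : Copy H G)
    (v : V) : (c.toSubgraph.neighborSet v).Finite := by
  by_cases hv : v ∈ Set.range c
  · obtain ⟨w, rfl⟩ := hv
    refine ((hH w).image c).subset ?_
    rintro _ ⟨w', x, hadj, hw', rfl⟩
    exact ⟨x, c.injective hw' ▸ hadj, rfl⟩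
  · refine Set.finite_empty.subset fun u hu => hv ?_
    rw [← verts_toSubgraph]
    exact hu.fst_mem

/-- For every finite set of vertices, `H` contains a copy of itself avoiding that set. -/
def HasCopiesOffFiniteSets (H : SimpleGraph W) : Prop :=
  ∀ F : Set W, F.Finite → ∃ d : Copy H H, ∀ w, d w ∉ F

theorem HasCopiesOffFiniteSets.exists_comp_notMem (hH : HasCopiesOffFiniteSets H)
    (c : Copy H G) {F : Set V} (hF : F.Finite) : ∃ d : Copy H H, ∀ w, c (d w) ∉ F :=
  hH (c ⁻¹' F) (hF.preimage c.injective.injOn)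

theorem exists_countable_subgraph [Countable W] (hG : HasArbitrarilyManyEdgeDisjoint G H) :
    ∃ K : G.Subgraph, Countable K.verts ∧ HasArbitrarilyManyEdgeDisjoint K.coe H := by
  choose c hc using fun k => hasEdgeDisjointFamily_iff_exists_copies.1 (hG k)
  refine ⟨⨆ (k) (j), (c k j).toSubgraph, ?_, fun k => (hc k).hasEdgeDisjointFamily_coe
    fun j => le_iSup₂_of_le k j le_rfl⟩
  simp only [Subgraph.verts_iSup, verts_toSubgraph]
  exact (Set.countable_iUnion fun k => Set.countable_iUnion fun j =>
    Set.countable_range _).to_subtype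

/-- Trimming the members of the `k`-th family so that they avoid the first `k` vertices leaves
only finitely many copies at every vertex. -/
theorem exists_locallyFinite_subgraph [Countable V] (hfin : ∀ w, (H.neighborSet w).Finite)
    (hH : HasCopiesOffFiniteSets H) (hG : HasArbitrarilyManyEdgeDisjoint G H) :
    ∃ K : G.Subgraph, (∀ v, (K.coe.neighborSet v).Finite) ∧
      HasArbitrarilyManyEdgeDisjoint K.coe H := by
  choose c hc using fun k => hasEdgeDisjointFamily_iff_exists_copies.1 (hG k)
  obtain ⟨F, -, hF⟩ := Filter.exists_seq_monotone_tendsto_atTop_atTop (Finset V)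
  choose d hd using fun k j => hH.exists_comp_notMem (c k j) (F k).finite_toSet
  have htrimmed (k : ℕ) : EdgeDisjointCopies fun j => (c k j).comp (d k j) :=
    (hc k).mono fun j => copyEdges_comp_subset _ _
  refine ⟨⨆ (k) (j), ((c k j).comp (d k j)).toSubgraph, fun v => ?_,
    fun k => (htrimmed k).hasEdgeDisjointFamily_coe fun j => le_iSup₂_of_le k j le_rfl⟩
  obtain ⟨n, hn⟩ := (hF.eventually_ge_atTop {v.1}).exists_forall_of_atTop
  refine Set.Finite.of_finite_image (f := Subtype.val) ?_ Subtype.val_injective.injOn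
  have hlarge (k : ℕ) (j : Fin k) (hk : n ≤ k) :
      ((c k j).comp (d k j)).toSubgraph.neighborSet v = ∅ := by
    refine Set.eq_empty_of_forall_notMem fun u hu => ?_
    obtain ⟨w, hw⟩ := (verts_toSubgraph ((c k j).comp (d k j))).subset hu.fst_mem
    exact hd k j w (hn k hk (by simpa using hw))
  have hunion := (Set.finite_lt_nat n).biUnion fun k _ => Set.finite_iUnion fun j =>
    finite_neighborSet_toSubgraph hfin ((c k j).comp (d k j)) v
  refine hunion.subset ?_
  rintro _ ⟨u, hu, rfl⟩
  simp only [mem_neighborSet, Subgraph.coe_adj, Subgraph.iSup_adj] at hu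
  obtain ⟨k, j, hkj⟩ := hu
  have hk : k < n := lt_of_not_ge fun hk => (hlarge k j hk).subset hkj
  exact Set.mem_biUnion hk (Set.mem_iUnion_of_mem j hkj)

theorem isEdgeUbiquitous_of_countable_locallyFinite [Countable W]
    (hfin : ∀ w, (H.neighborSet w).Finite) (hH : HasCopiesOffFiniteSets H)
    (h : ∀ (V : Type u) [Countable V] (G : SimpleGraph V), (∀ v, (G.neighborSet v).Finite) →
      HasArbitrarilyManyEdgeDisjoint G H → HasInfinitelyManyEdgeDisjoint G H) :
    IsEdgeUbiquitous.{u} H := by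
  intro V G hG
  obtain ⟨K, hKcount, hK⟩ := exists_countable_subgraph hG
  obtain ⟨L, hLfin, hL⟩ := exists_locallyFinite_subgraph hfin hH hK
  exact ((h L.verts L.coe hLfin hL).map L.coeCopy).map K.coeCopy

end Reduction

section MultiRay

variable {J V ι κ : Type*} {G : SimpleGraph V}

/-- The vertex-disjoint union of rays indexed by `ι`; the vertex `(i, n)` is the `n`-th vertex of
the `i`-th ray. -/
def multiRay (ι : Type*) : SimpleGraph (ι × ℕ) := (⊥ : SimpleGraph ι) □ rayGraph

theorem rayGraph_adj {m n : ℕ} : rayGraph.Adj m n ↔ m + 1 = n ∨ n + 1 = m := by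
  simp [rayGraph, Nat.covBy_iff_add_one_eq]

theorem multiRay_adj {p q : ι × ℕ} :
    (multiRay ι).Adj p q ↔ p.1 = q.1 ∧ (p.2 + 1 = q.2 ∨ q.2 + 1 = p.2) := by
  simp [multiRay, rayGraph_adj, and_comm]

theorem nonempty_multiRay_bool_iso_twoRayGraph : Nonempty (multiRay Bool ≃g twoRayGraph) := by
  refine ⟨⟨Equiv.boolProdEquivSum ℕ, ?_⟩⟩
  rintro ⟨_ | _, m⟩ ⟨_ | _, n⟩ <;> simp [twoRayGraph, multiRay_adj, rayGraph_adj]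

/-- The copy of `multiRay ι` in itself that drops the first `m` vertices of each ray. -/
def multiRayShift (ι : Type*) (m : ℕ) : Copy (multiRay ι) (multiRay ι) where
  toHom := ⟨fun p => (p.1, p.2 + m), fun {p q} h => by
    simpa only [multiRay_adj, add_right_comm _ m 1, Nat.add_right_cancel_iff] using h⟩
  injective' := fun p q h => by
    simpa [Prod.ext_iff] using h

@[simp]
theorem multiRayShift_apply (m : ℕ) (p : ι × ℕ) : multiRayShift ι m p = (p.1, p.2 + m) := rfl

/-- The copy of `multiRay ι` in `multiRay κ` induced by an injection of the index types. -/
def multiRayReindex (e : ι ↪ κ) : Copy (multiRay ι) (multiRay κ) where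
  toHom := ⟨fun p => (e p.1, p.2), fun {p q} h => by
    simpa only [multiRay_adj, e.apply_eq_iff_eq] using h⟩
  injective' := fun p q h => by
    simpa [Prod.ext_iff] using h

@[simp]
theorem multiRayReindex_apply (e : ι ↪ κ) (p : ι × ℕ) : multiRayReindex e p = (e p.1, p.2) := rfl

theorem exists_multiRayShift_notMem (c : Copy (multiRay ι) G) {F : Set V} (hF : F.Finite) :
    ∃ m, ∀ p, c (multiRayShift ι m p) ∉ F := by
  obtain ⟨b, hb⟩ := ((hF.preimage c.injective.injOn).image Prod.snd).bddAbove
  refine ⟨b + 1, fun p hp => ?_⟩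
  have hle : p.2 + (b + 1) ≤ b := hb ⟨multiRayShift ι (b + 1) p, hp, rfl⟩
  omega

theorem hasCopiesOffFiniteSets_multiRay (ι : Type*) : HasCopiesOffFiniteSets (multiRay ι) :=
  fun _ hF => (exists_multiRayShift_notMem (Copy.id _) hF).imp' (multiRayShift ι) fun _ h => h

theorem finite_neighborSet_multiRay (p : ι × ℕ) : ((multiRay ι).neighborSet p).Finite := by
  refine ((Set.finite_le_nat (p.2 + 1)).image (Prod.mk p.1)).subset fun q hq => ?_
  obtain ⟨hfst, hsnd⟩ := multiRay_adj.1 hq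
  exact ⟨q.2, show q.2 ≤ p.2 + 1 by omega, Prod.ext hfst rfl⟩

theorem hasEdgeDisjointFamily_multiRay_prod (J ι : Type*) :
    HasEdgeDisjointFamily J (multiRay (J × ι)) (multiRay ι) := by
  refine hasEdgeDisjointFamily_iff_exists_copies.2
    ⟨fun j => multiRayReindex ⟨Prod.mk j, Prod.mk_right_injective j⟩, fun j k hjk => ?_⟩
  refine Set.disjoint_left.2 ?_
  rintro _ ⟨e, -, rfl⟩ ⟨f, -, hef⟩
  induction e with | _ p q
  induction f with | _ r s
  simp [Prod.ext_iff, hjk.symm] at hef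

end MultiRay

section Arcs

variable {V ι : Type*} {G : SimpleGraph V} {c d : Copy (multiRay ι) G} {u v : V}

/-- `Arc c u v` says that `v` comes right after `u` on one of the rays of `c`, directed away from
their starting vertices. -/
def Arc (c : Copy (multiRay ι) G) (u v : V) : Prop := ∃ i n, c (i, n) = u ∧ c (i, n + 1) = v

theorem Arc.mk_mem_copyEdges (h : Arc c u v) : s(u, v) ∈ copyEdges c := by
  obtain ⟨i, n, rfl, rfl⟩ := h
  exact ⟨s((i, n), (i, n + 1)), by simp [multiRay_adj], rfl⟩

theorem mk_mem_copyEdges_iff : s(u, v) ∈ copyEdges c ↔ Arc c u v ∨ Arc c v u := by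
  refine ⟨?_, fun h => h.elim Arc.mk_mem_copyEdges fun h => Sym2.eq_swap ▸ h.mk_mem_copyEdges⟩
  rintro ⟨e, he, huv⟩
  induction e with | _ p q
  obtain ⟨i, m⟩ := p
  obtain ⟨j, n⟩ := q
  obtain ⟨rfl : i = j, (rfl : m + 1 = n) | (rfl : n + 1 = m)⟩ := multiRay_adj.1 he <;>
  rcases Sym2.eq_iff.1 huv with ⟨rfl, rfl⟩ | ⟨rfl, rfl⟩
  exacts [.inl ⟨_, _, rfl, rfl⟩, .inr ⟨_, _, rfl, rfl⟩, .inr ⟨_, _, rfl, rfl⟩,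
    .inl ⟨_, _, rfl, rfl⟩]

theorem Arc.adj (h : Arc c u v) : G.Adj u v :=
  copyEdges_subset_edgeSet c h.mk_mem_copyEdges

end Arcs

section Flows

variable {V ι : Type*} {G : SimpleGraph V} {D : V → V → Prop}

/-- A relation `D` is a flow if every vertex has at most one `D`-successor and at most one
`D`-predecessor, and has a successor as soon as it has a predecessor: every component of `D` is
then a directed ray, double ray or cycle. -/
structure IsFlow (D : V → V → Prop) : Prop where
  succ_subsingleton : ∀ u, {w | D u w}.Subsingleton
  pred_subsingleton : ∀ w, {u | D u w}.Subsingleton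
  exists_succ : ∀ {u v}, D u v → ∃ w, D v w

theorem isFlow_arc (c : Copy (multiRay ι) G) : IsFlow (Arc c) where
  succ_subsingleton := by
    rintro _ _ ⟨i, m, rfl, rfl⟩ _ ⟨j, n, h, rfl⟩
    obtain ⟨rfl, rfl⟩ := Prod.ext_iff.1 (c.injective h)
    rfl
  pred_subsingleton := by
    rintro _ _ ⟨i, m, rfl, rfl⟩ _ ⟨j, n, rfl, h⟩
    obtain ⟨rfl, hn⟩ := Prod.ext_iff.1 (c.injective h)
    rw [Nat.succ_injective hn]
  exists_succ := by
    rintro _ _ ⟨i, n, rfl, rfl⟩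
    exact ⟨_, i, n + 1, rfl, rfl⟩

theorem iterate_injective_of_notMem_range {f : V → V} (hf : Function.Injective f) {a : ι → V}
    (ha : Function.Injective a) (hrange : ∀ i, a i ∉ Set.range f) :
    Function.Injective fun p : ι × ℕ => f^[p.2] (a p.1) := by
  have hle {i j : ι} {m n : ℕ} (h : f^[m] (a i) = f^[n] (a j)) : n ≤ m := by
    by_contra! hlt
    obtain ⟨k, rfl⟩ := Nat.exists_eq_add_of_lt hlt
    rw [add_assoc, Function.iterate_add_apply, Function.iterate_succ_apply'] at h
    exact hrange i ⟨_, (hf.iterate m h).symm⟩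
  rintro ⟨i, m⟩ ⟨j, n⟩ h
  obtain rfl : m = n := (hle h.symm).antisymm (hle h)
  exact Prod.ext (ha (hf.iterate m h)) rfl

theorem IsFlow.exists_copy (hD : IsFlow D) (hG : ∀ u v, D u v → G.Adj u v) {a : ι → V}
    (ha : Function.Injective a) (hsucc : ∀ i, ∃ w, D (a i) w) (hpred : ∀ i u, ¬D u (a i)) :
    ∃ c : Copy (multiRay ι) G, ∀ u v, Arc c u v → D u v := by
  choose f hf using fun v : {v // ∃ w, D v w} => v.2
  let next (v : {v // ∃ w, D v w}) : {v // ∃ w, D v w} := ⟨f v, hD.exists_succ (hf v)⟩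
  have hnext : Function.Injective next := fun u v h => by
    have hfuv : f u = f v := congrArg Subtype.val h
    exact Subtype.ext (hD.pred_subsingleton _ (hf u) (hfuv ▸ hf v))
  let source (i : ι) : {v // ∃ w, D v w} := ⟨a i, hsucc i⟩
  have hsource (i : ι) : source i ∉ Set.range next := by
    rintro ⟨v, hv⟩
    have hfv : f v = a i := congrArg Subtype.val hv
    exact hpred i v (hfv ▸ hf v)
  let path (p : ι × ℕ) : V := next^[p.2] (source p.1)
  have hpath : Function.Injective path := Subtype.val_injective.comp <|
    iterate_injective_of_notMem_range hnext (fun i j h => ha (congrArg Subtype.val h)) hsource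
  have harc (i : ι) (n : ℕ) : D (path (i, n)) (path (i, n + 1)) := by
    simp only [path, Function.iterate_succ_apply']
    exact hf _
  refine ⟨⟨⟨path, ?_⟩, hpath⟩, ?_⟩
  · rintro ⟨i, m⟩ ⟨j, n⟩ h
    obtain ⟨rfl : i = j, (rfl : m + 1 = n) | (rfl : n + 1 = m)⟩ := multiRay_adj.1 h
    exacts [hG _ _ (harc i m), (hG _ _ (harc i n)).symm]
  · rintro _ _ ⟨i, n, rfl, rfl⟩
    exact harc i n

end Flows

section Gluing

variable {V ι : Type*} {G : SimpleGraph V}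

/-- The vertices outside `C` reached from `C` by a single `D`-step. -/
def outBoundary (C : Set V) (D : V → V → Prop) : Set V := {v | v ∉ C ∧ ∃ u ∈ C, D u v}

/-- The vertices outside `C` at which `D` leaves `C`, and those from which `D` enters `C`. -/
def crossingPattern (C : Set V) (D : V → V → Prop) : Set V × Set V :=
  (outBoundary C D, outBoundary C (flip D))

/-- The relation that follows `Y c` on the edges whose lower endvertex has level `c`. -/
def glue (ℓ : V → ℕ) (Y : ℕ → V → V → Prop) (u v : V) : Prop := Y (min (ℓ u) (ℓ v)) u v

/-- A sequence of relations whose steps change the level by at most one, such that the `c`-th and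
the `(c + 1)`-st one cross the boundary of the set of vertices of level at most `c` alike. -/
structure IsGluable (ℓ : V → ℕ) (Y : ℕ → V → V → Prop) : Prop where
  level_le : ∀ {c u v}, Y c u v → ℓ v ≤ ℓ u + 1
  level_le' : ∀ {c u v}, Y c u v → ℓ u ≤ ℓ v + 1
  crossingPattern_eq : ∀ c, crossingPattern {x | ℓ x ≤ c} (Y c) =
    crossingPattern {x | ℓ x ≤ c} (Y (c + 1))

variable {ℓ : V → ℕ} {Y : ℕ → V → V → Prop} {u v : V}

theorem flip_glue : flip (glue ℓ Y) = glue ℓ fun c => flip (Y c) := by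
  funext u v
  simp only [flip, glue, min_comm]

namespace IsGluable

theorem flip (h : IsGluable ℓ Y) : IsGluable ℓ fun c => flip (Y c) where
  level_le := h.level_le'
  level_le' := h.level_le
  crossingPattern_eq c := congrArg Prod.swap (h.crossingPattern_eq c)

theorem glue_iff (h : IsGluable ℓ Y) :
    glue ℓ Y u v ↔ ℓ v ≤ ℓ u ∧ Y (ℓ v) u v ∨ ∃ c, ℓ v = c + 1 ∧ ℓ u ≤ c ∧ Y c u v := by
  constructor
  · intro huv
    rcases le_or_gt (ℓ v) (ℓ u) with hle | hlt
    · exact .inl ⟨hle, min_eq_right hle ▸ huv⟩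
    · have hstep := h.level_le huv
      exact .inr ⟨ℓ u, by omega, le_rfl, min_eq_left hlt.le ▸ huv⟩
  · rintro (⟨hle, huv⟩ | ⟨c, hv, hu, huv⟩)
    · rwa [glue, min_eq_right hle]
    · have hstep := h.level_le huv
      rwa [glue, show min (ℓ u) (ℓ v) = c by omega]

theorem exists_pred_le_iff (h : IsGluable ℓ Y) {c : ℕ} (hv : ℓ v = c + 1) :
    (∃ u, ℓ u ≤ c ∧ Y c u v) ↔ ∃ u, ℓ u ≤ c ∧ Y (c + 1) u v := by
  have hout := Set.ext_iff.1 (congrArg Prod.fst (h.crossingPattern_eq c)) v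
  simpa [crossingPattern, outBoundary, hv] using hout

theorem exists_glue_pred_iff (h : IsGluable ℓ Y) : (∃ u, glue ℓ Y u v) ↔ ∃ u, Y (ℓ v) u v := by
  simp only [h.glue_iff]
  constructor
  · rintro ⟨u, ⟨-, huv⟩ | ⟨c, hv, hu, huv⟩⟩
    · exact ⟨u, huv⟩
    · obtain ⟨w, -, hwv⟩ := (h.exists_pred_le_iff hv).1 ⟨u, hu, huv⟩
      exact ⟨w, hv ▸ hwv⟩
  · rintro ⟨u, huv⟩
    rcases le_or_gt (ℓ v) (ℓ u) with hle | hlt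
    · exact ⟨u, .inl ⟨hle, huv⟩⟩
    · obtain ⟨c, hv⟩ := Nat.exists_eq_add_one_of_ne_zero (Nat.ne_zero_of_lt hlt)
      obtain ⟨w, hw, hwv⟩ := (h.exists_pred_le_iff hv).2 ⟨u, by omega, hv ▸ huv⟩
      exact ⟨w, .inr ⟨c, hv, hw, hwv⟩⟩

theorem exists_glue_succ_iff (h : IsGluable ℓ Y) : (∃ w, glue ℓ Y v w) ↔ ∃ w, Y (ℓ v) v w := by
  have hflip := h.flip.exists_glue_pred_iff (v := v)
  rwa [← flip_glue] at hflip

theorem glue_pred_subsingleton (h : IsGluable ℓ Y) (hY : ∀ c v, {u | Y c u v}.Subsingleton)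
    (v : V) : {u | glue ℓ Y u v}.Subsingleton := by
  have not_both {u u' : V} {c : ℕ} (hv : ℓ v = c + 1) (hu : ℓ u ≤ c) (huv : Y c u v)
      (hle : ℓ v ≤ ℓ u') (huv' : Y (ℓ v) u' v) : False := by
    obtain ⟨w, hw, hwv⟩ := (h.exists_pred_le_iff hv).1 ⟨u, hu, huv⟩
    obtain rfl : w = u' := hY (ℓ v) v (hv ▸ hwv) huv'
    omega
  intro u hu u' hu'
  rcases h.glue_iff.1 hu with ⟨hle, huv⟩ | ⟨c, hv, huc, huv⟩ <;>
  rcases h.glue_iff.1 hu' with ⟨hle', huv'⟩ | ⟨c', hv', huc', huv'⟩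
  · exact hY _ _ huv huv'
  · exact (not_both hv' huc' huv' hle huv).elim
  · exact (not_both hv huc huv hle' huv').elim
  · obtain rfl : c = c' := by omega
    exact hY _ _ huv huv'

theorem isFlow_glue (h : IsGluable ℓ Y) (hY : ∀ c, IsFlow (Y c)) : IsFlow (glue ℓ Y) where
  succ_subsingleton u := by
    have hflip := h.flip.glue_pred_subsingleton (fun c => (hY c).succ_subsingleton) u
    rwa [← flip_glue] at hflip
  pred_subsingleton := h.glue_pred_subsingleton fun c => (hY c).pred_subsingleton
  exists_succ huv := by
    obtain ⟨u, hu⟩ := h.exists_glue_pred_iff.1 ⟨_, huv⟩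
    exact h.exists_glue_succ_iff.2 ((hY _).exists_succ hu)

end IsGluable

theorem exists_level_le_iff {A : ℕ → Set V} (hmono : Monotone A) (hcover : ∀ v, ∃ c, v ∈ A c) :
    ∃ ℓ : V → ℕ, ∀ v c, ℓ v ≤ c ↔ v ∈ A c := by
  classical
  exact ⟨fun v => Nat.find (hcover v), fun v c => (Nat.find_le_iff _ _).trans
    ⟨fun ⟨m, hm, hv⟩ => hmono hm hv, fun hv => ⟨c, le_rfl, hv⟩⟩⟩

/-- Stagewise approximations of infinitely many edge-disjoint copies of `multiRay ι`, relative to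
an increasing exhaustion `A` of the vertex set: `Y n c` is what the `n`-th copy is meant to look
like between `A c` and `A (c + 1)`; it is significant only for `n < c`. -/
structure IsStrandSystem (A : ℕ → Set V) (Y : ℕ → ℕ → Copy (multiRay ι) G) : Prop where
  disjoint : ∀ {m n c}, m < c → n < c → m ≠ n →
    Disjoint (copyEdges (Y m c)) (copyEdges (Y n c))
  crossingPattern_eq : ∀ {n c}, n < c →
    crossingPattern (A c) (Arc (Y n c)) = crossingPattern (A c) (Arc (Y n (c + 1)))
  notMem : ∀ n p, Y n (n + 1) p ∉ A n
  start_mem : ∀ n i, Y n (n + 1) (i, 0) ∈ A (n + 1)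

theorem Arc.not_start {c : Copy (multiRay ι) G} {i : ι} : ¬Arc c u (c (i, 0)) := by
  rintro ⟨j, n, -, h⟩
  exact Nat.succ_ne_zero n (congrArg Prod.snd (c.injective h))

variable {A : ℕ → Set V} {Y : ℕ → ℕ → Copy (multiRay ι) G}

theorem IsStrandSystem.isGluable
    (h : IsStrandSystem A Y) (hℓ : ∀ v c, ℓ v ≤ c ↔ v ∈ A c)
    (hadj : ∀ u v, G.Adj u v → ℓ v ≤ ℓ u + 1) (n : ℕ) :
    IsGluable ℓ fun c => Arc (Y n (max c (n + 1))) where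
  level_le huv := hadj _ _ huv.adj
  level_le' huv := hadj _ _ huv.adj.symm
  crossingPattern_eq c := by
    rw [show {x | ℓ x ≤ c} = A c from Set.ext fun x => hℓ x c]
    rcases lt_or_ge n c with hc | hc
    · rw [max_eq_left (by omega), max_eq_left (by omega)]
      exact h.crossingPattern_eq hc
    · rw [max_eq_right (by omega), max_eq_right (by omega)]

theorem IsStrandSystem.exists_copy
    (h : IsStrandSystem A Y) (hℓ : ∀ v c, ℓ v ≤ c ↔ v ∈ A c)
    (hadj : ∀ u v, G.Adj u v → ℓ v ≤ ℓ u + 1) (n : ℕ) :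
    ∃ s : Copy (multiRay ι) G, ∀ u v, Arc s u v →
      n < min (ℓ u) (ℓ v) ∧ Arc (Y n (min (ℓ u) (ℓ v))) u v := by
  have hlt (p : ι × ℕ) : n < ℓ (Y n (n + 1) p) :=
    lt_of_not_ge fun hle => h.notMem n p ((hℓ _ _).1 hle)
  have hstart (i : ι) : ℓ (Y n (n + 1) (i, 0)) = n + 1 :=
    le_antisymm ((hℓ _ _).2 (h.start_mem n i)) (hlt _)
  have hglue := h.isGluable hℓ hadj n
  let Z (c : ℕ) : V → V → Prop := Arc (Y n (max c (n + 1)))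
  have hsucc (i : ι) : ∃ w, glue ℓ Z (Y n (n + 1) (i, 0)) w := by
    rw [hglue.exists_glue_succ_iff, hstart, max_self]
    exact ⟨_, i, 0, rfl, rfl⟩
  have hpred (i : ι) : ¬∃ u, glue ℓ Z u (Y n (n + 1) (i, 0)) := by
    rw [hglue.exists_glue_pred_iff, hstart, max_self]
    exact fun ⟨_, hu⟩ => hu.not_start
  obtain ⟨s, hs⟩ := (hglue.isFlow_glue fun c => isFlow_arc _).exists_copy (fun u v huv => huv.adj)
    (fun i j hij => congrArg Prod.fst ((Y n (n + 1)).injective hij)) hsucc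
    fun i u hu => hpred i ⟨u, hu⟩
  refine ⟨s, fun u v huv => ?_⟩
  have harc : Arc (Y n (max (min (ℓ u) (ℓ v)) (n + 1))) u v := hs u v huv
  have hmin : n < min (ℓ u) (ℓ v) := by
    by_contra! hle
    rw [max_eq_right (by omega)] at harc
    obtain ⟨i, m, rfl, rfl⟩ := harc
    exact (lt_min (hlt _) (hlt _)).not_ge hle
  exact ⟨hmin, max_eq_left (Nat.succ_le_of_lt hmin) ▸ harc⟩

theorem IsStrandSystem.hasEdgeDisjointFamily
    (h : IsStrandSystem A Y) (hmono : Monotone A) (hcover : ∀ v, ∃ c, v ∈ A c)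
    (hA : ∀ c, outBoundary (A c) G.Adj ⊆ A (c + 1)) :
    HasEdgeDisjointFamily ℕ G (multiRay ι) := by
  obtain ⟨ℓ, hℓ⟩ := exists_level_le_iff hmono hcover
  have hadj (u v : V) (huv : G.Adj u v) : ℓ v ≤ ℓ u + 1 := by
    by_cases hv : v ∈ A (ℓ u)
    · exact ((hℓ _ _).2 hv).trans (Nat.le_succ _)
    · exact (hℓ _ _).2 (hA _ ⟨hv, u, (hℓ _ _).1 le_rfl, huv⟩)
  choose s hs using h.exists_copy hℓ hadj
  have hmem {n : ℕ} {u v : V} (huv : s(u, v) ∈ copyEdges (s n)) :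
      n < min (ℓ u) (ℓ v) ∧ s(u, v) ∈ copyEdges (Y n (min (ℓ u) (ℓ v))) := by
    rcases mk_mem_copyEdges_iff.1 huv with harc | harc
    · exact (hs n u v harc).imp_right Arc.mk_mem_copyEdges
    · rw [min_comm, Sym2.eq_swap]
      exact (hs n v u harc).imp_right Arc.mk_mem_copyEdges
  refine hasEdgeDisjointFamily_iff_exists_copies.2 ⟨s, fun m n hmn => Set.disjoint_left.2 ?_⟩
  intro e hm hn
  induction e with | _ u v
  obtain ⟨hlt, hm⟩ := hmem hm
  obtain ⟨hlt', hn⟩ := hmem hn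
  exact Set.disjoint_left.1 (h.disjoint hlt hlt' hmn) hm hn

end Gluing

section Hall

variable {ι α : Type*} {t : ι → Finset α} {I J : Set α} {A B : Finset ι} {x : α}

open Classical in
/-- The elements outside `I` of the sets `t i` with `i ∈ A`. -/
noncomputable def choicesOff (t : ι → Finset α) (I : Set α) (A : Finset ι) : Finset α :=
  {x ∈ A.biUnion t | x ∉ I}

/-- Hall's condition for the sets `t i` with the elements of `I` removed. -/
def HallAvoiding (t : ι → Finset α) (I : Set α) : Prop :=
  ∀ A : Finset ι, A.card ≤ (choicesOff t I A).card

theorem mem_choicesOff : x ∈ choicesOff t I A ↔ (∃ i ∈ A, x ∈ t i) ∧ x ∉ I := by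
  simp [choicesOff]

theorem choicesOff_anti (h : I ⊆ J) : choicesOff t J A ⊆ choicesOff t I A := fun _ hx =>
  mem_choicesOff.2 ((mem_choicesOff.1 hx).imp_right fun hJ hI => hJ (h hI))

theorem choicesOff_mono (h : A ⊆ B) : choicesOff t I A ⊆ choicesOff t I B := fun _ hx =>
  mem_choicesOff.2 ((mem_choicesOff.1 hx).imp_left fun ⟨i, hi, hxi⟩ => ⟨i, h hi, hxi⟩)

theorem choicesOff_union [DecidableEq ι] [DecidableEq α] :
    choicesOff t I (A ∪ B) = choicesOff t I A ∪ choicesOff t I B := by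
  ext x
  simp only [Finset.mem_union, mem_choicesOff, or_and_right, exists_or]

theorem choicesOff_insert [DecidableEq α] :
    choicesOff t (insert x I) A = (choicesOff t I A).erase x := by
  ext y
  simp only [Finset.mem_erase, mem_choicesOff, Set.mem_insert_iff, not_or]
  tauto

theorem hallAvoiding_isOfFiniteCharacter (t : ι → Finset α) :
    Order.IsOfFiniteCharacter {I | HallAvoiding t I} := by
  refine fun I => ⟨fun hI J hJ _ A => (hI A).trans (Finset.card_le_card (choicesOff_anti hJ)),
    fun h A => ?_⟩
  classical
  have hfin : (I ∩ A.biUnion t).Finite := (A.biUnion t).finite_toSet.inter_of_right I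
  refine (h _ Set.inter_subset_left hfin A).trans (Finset.card_le_card fun x hx => ?_)
  obtain ⟨hxA, hxI⟩ := mem_choicesOff.1 hx
  exact mem_choicesOff.2 ⟨hxA, fun hI => hxI ⟨hI, by simpa using hxA⟩⟩

theorem HallAvoiding.exists_injective (h : HallAvoiding t I) :
    ∃ f : ι → α, Function.Injective f ∧ ∀ i, f i ∈ t i ∧ f i ∉ I := by
  classical
  obtain ⟨f, hf, hft⟩ := (Finset.all_card_le_biUnion_card_iff_exists_injective
    fun i => {x ∈ t i | x ∉ I}).1 fun A => by
      rw [← Finset.filter_biUnion]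
      exact h A
  exact ⟨f, hf, fun i => Finset.mem_filter.1 (hft i)⟩

/-- Sets attaining equality in Hall's condition are closed under unions, by submodularity of
`A ↦ (choicesOff t I A).card`. -/
theorem HallAvoiding.card_choicesOff_union_le [DecidableEq ι] (h : HallAvoiding t I)
    (hA : (choicesOff t I A).card ≤ A.card) (hB : (choicesOff t I B).card ≤ B.card) :
    (choicesOff t I (A ∪ B)).card ≤ (A ∪ B).card := by
  classical
  have hinter : choicesOff t I (A ∩ B) ⊆ choicesOff t I A ∩ choicesOff t I B :=
    Finset.subset_inter (choicesOff_mono Finset.inter_subset_left)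
      (choicesOff_mono Finset.inter_subset_right)
  have hle := (h (A ∩ B)).trans (Finset.card_le_card hinter)
  have hsum := Finset.card_union_add_card_inter (choicesOff t I A) (choicesOff t I B)
  have hsum' := Finset.card_union_add_card_inter A B
  rw [choicesOff_union]
  omega

theorem exists_tight_mem_choicesOff (h : Maximal (HallAvoiding t) I) (hx : x ∉ I) :
    ∃ A, (choicesOff t I A).card ≤ A.card ∧ x ∈ choicesOff t I A := by
  classical
  have hnot : ¬HallAvoiding t (insert x I) := fun hins =>
    hx (h.2 hins (Set.subset_insert x I) (Set.mem_insert x I))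
  obtain ⟨A, hA⟩ := not_forall.1 hnot
  rw [choicesOff_insert, not_le] at hA
  have hxA : x ∈ choicesOff t I A := by
    by_contra hxA
    rw [Finset.erase_eq_of_notMem hxA] at hA
    exact hA.not_ge (h.1 A)
  rw [Finset.card_erase_of_mem hxA] at hA
  exact ⟨A, by omega, hxA⟩

theorem exists_tight_forall_mem_choicesOff (h : Maximal (HallAvoiding t) I) (F : Finset α) :
    ∃ A, (choicesOff t I A).card ≤ A.card ∧ ∀ x ∈ F, x ∉ I → x ∈ choicesOff t I A := by
  classical
  induction F using Finset.induction_on with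
  | empty => exact ⟨∅, by simp [choicesOff], by simp⟩
  | insert y F _ ih =>
    obtain ⟨A, hA, hF⟩ := ih
    by_cases hy : y ∈ I
    · exact ⟨A, hA, Finset.forall_mem_insert _ _ _ |>.2 ⟨fun h => absurd hy h, hF⟩⟩
    · obtain ⟨B, hB, hyB⟩ := exists_tight_mem_choicesOff h hy
      refine ⟨B ∪ A, h.1.card_choicesOff_union_le hB hA,
        (Finset.forall_mem_insert _ _ _).2 ⟨fun _ => choicesOff_mono Finset.subset_union_left hyB,
          fun x hx hxI => choicesOff_mono Finset.subset_union_right (hF x hx hxI)⟩⟩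

end Hall

section Dichotomy

variable {V : Type*} {G : SimpleGraph V}

/-- If `I` is finite, adjoining to `B` a set attaining equality in Hall's condition and exhausting
the closed neighbourhood of `B` off `I` leaves at most `I.ncard` boundary vertices. -/
theorem exists_encard_outBoundary_le {t : V → Finset V} (ht : ∀ v, v ∈ t v)
    (hadj : ∀ u v, G.Adj u v → v ∈ t u) {I : Set V} (hI : Maximal (HallAvoiding t) I)
    (hfin : I.Finite) (B : Finset V) :
    ∃ A : Finset V, B ⊆ A ∧ (outBoundary A G.Adj).encard ≤ hfin.toFinset.card := by
  classical
  obtain ⟨A, htight, hB⟩ := exists_tight_forall_mem_choicesOff hI (B.biUnion t)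
  set N : Finset V := choicesOff t I A ∪ hfin.toFinset with hN
  have hmemN {v : V} (hv : v ∈ I ∨ v ∈ choicesOff t I A) : v ∈ N := by
    simpa [hN, or_comm] using hv
  have hsub : outBoundary (A ∪ B : Finset V) G.Adj ⊆ (N \ A : Finset V) := by
    rintro v ⟨hv, u, hu, huv⟩
    rw [Finset.mem_coe, Finset.mem_union] at hv hu
    have hvt := hadj u v huv
    refine Finset.mem_sdiff.2 ⟨hmemN (or_iff_not_imp_left.2 fun hvI => ?_), fun h => hv (.inl h)⟩
    rcases hu with hu | hu
    · exact mem_choicesOff.2 ⟨⟨u, hu, hvt⟩, hvI⟩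
    · exact hB v (Finset.mem_biUnion.2 ⟨u, hu, hvt⟩) hvI
  have hAN : A ⊆ N := fun v hv =>
    hmemN (or_iff_not_imp_left.2 fun hvI => mem_choicesOff.2 ⟨⟨v, hv, ht v⟩, hvI⟩)
  have hcard : (N \ A).card ≤ hfin.toFinset.card := by
    rw [Finset.card_sdiff_of_subset hAN]
    have hunion : N.card ≤ _ := Finset.card_union_le _ _
    omega
  refine ⟨A ∪ B, Finset.subset_union_right, (Set.encard_le_encard hsub).trans ?_⟩
  rw [Set.encard_coe_eq_coe_finsetCard]
  exact_mod_cast hcard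

theorem exists_injective_avoiding_or_outBoundary_le (hG : ∀ v, (G.neighborSet v).Finite) :
    (∃ (I : Set V) (f : V → V), I.Infinite ∧ Function.Injective f ∧
      (∀ v, f v = v ∨ G.Adj v (f v)) ∧ ∀ v, f v ∉ I) ∨
    ∃ d : ℕ, ∀ B : Finset V, ∃ A : Finset V, B ⊆ A ∧ (outBoundary A G.Adj).encard ≤ d := by
  classical
  let t (v : V) : Finset V := insert v (hG v).toFinset
  have ht (v : V) : v ∈ t v := Finset.mem_insert_self _ _
  have hempty : HallAvoiding t ∅ := fun A => Finset.card_le_card fun v hv =>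
    mem_choicesOff.2 ⟨⟨v, hv, ht v⟩, Set.notMem_empty v⟩
  obtain ⟨I, -, hI⟩ := (hallAvoiding_isOfFiniteCharacter t).exists_maximal hempty
  rcases I.finite_or_infinite with hfin | hinf
  · exact .inr ⟨_, exists_encard_outBoundary_le ht (fun u v huv => by simp [t, huv]) hI hfin⟩
  · obtain ⟨f, hf, hft⟩ := hI.1.exists_injective
    exact .inl ⟨I, f, hinf, hf, fun v => by simpa [t] using (hft v).1, fun v => (hft v).2⟩

theorem hasEdgeDisjointFamily_of_injective_avoiding (ι : Type*) [Countable ι] {I : Set V}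
    {f : V → V} (hI : I.Infinite) (hf : Function.Injective f)
    (hadj : ∀ v, f v = v ∨ G.Adj v (f v)) (hfI : ∀ v, f v ∉ I) :
    HasEdgeDisjointFamily ℕ G (multiRay ι) := by
  have hflow : IsFlow fun u v => f u = v ∧ u ≠ v :=
    { succ_subsingleton := fun u v hv w hw => hv.1.symm.trans hw.1
      pred_subsingleton := fun w u hu v hv => hf (hu.1.trans hv.1.symm)
      exists_succ := by
        rintro u _ ⟨rfl, hne⟩
        exact ⟨_, rfl, fun h => hne (hf h)⟩ }
  have := hI.to_subtype
  obtain ⟨e, he⟩ := Countable.exists_injective_nat (ℕ × ι)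
  let a : ℕ × ι ↪ I := (⟨e, he⟩ : ℕ × ι ↪ ℕ).trans (Infinite.natEmbedding I)
  obtain ⟨c, -⟩ := hflow.exists_copy (G := G)
    (fun u v h => h.1 ▸ (hadj u).resolve_left fun hu => h.2 (hu.symm.trans h.1))
    (Subtype.val_injective.comp a.injective)
    (fun i => ⟨_, rfl, fun h => hfI (a i) (h ▸ (a i).2)⟩)
    fun i u h => hfI u (h.1 ▸ (a i).2)
  exact (hasEdgeDisjointFamily_multiRay_prod ℕ ι).map c

end Dichotomy

section BoundedBoundary

variable {V ι κ : Type*} {G : SimpleGraph V} {C : ℕ → Finset V} {d : ℕ}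

/-- An exhaustion of `G` by finite sets with at most `d` outer boundary vertices each. -/
structure IsBoundedExhaustion (G : SimpleGraph V) (d : ℕ) (C : ℕ → Finset V) : Prop where
  monotone : Monotone C
  exists_mem : ∀ v, ∃ i, v ∈ C i
  outBoundary_subset : ∀ i, outBoundary (C i) G.Adj ⊆ C (i + 1)
  encard_le : ∀ i, (outBoundary (C i) G.Adj).encard ≤ d

theorem exists_isBoundedExhaustion [Countable V]
    (hd : ∀ B : Finset V, ∃ A : Finset V, B ⊆ A ∧ (outBoundary A G.Adj).encard ≤ d) :
    ∃ C, IsBoundedExhaustion G d C := by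
  classical
  obtain ⟨F, -, hF⟩ := Filter.exists_seq_monotone_tendsto_atTop_atTop (Finset V)
  have hnext (A : {A : Finset V // (outBoundary A G.Adj).encard ≤ d}) (B : Finset V) :
      ∃ A' : {A : Finset V // (outBoundary A G.Adj).encard ≤ d},
        A.1 ⊆ A'.1 ∧ B ⊆ A'.1 ∧ outBoundary A.1 G.Adj ⊆ A'.1 := by
    have hfin := Set.finite_of_encard_le_coe A.2
    obtain ⟨A', hsub, hA'⟩ := hd (A.1 ∪ B ∪ hfin.toFinset)
    simp only [Finset.union_subset_iff, Set.Finite.toFinset_subset] at hsub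
    exact ⟨⟨A', hA'⟩, hsub.1.1, hsub.1.2, hsub.2⟩
  choose next hself hincl hbdry using hnext
  obtain ⟨A₀, -, hA₀⟩ := hd ∅
  obtain ⟨C, hC⟩ : ∃ C : ℕ → {A : Finset V // (outBoundary A G.Adj).encard ≤ d},
      ∀ i, C (i + 1) = next (C i) (F i) :=
    ⟨Nat.rec ⟨A₀, hA₀⟩ fun i A => next A (F i), fun _ => rfl⟩
  refine ⟨fun i => (C i).1, monotone_nat_of_le_succ fun i => ?_, fun v => ?_, fun i => ?_,
    fun i => (C i).2⟩
  · exact hC i ▸ hself (C i) (F i)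
  · obtain ⟨i, hi⟩ := (hF.eventually_ge_atTop {v}).exists
    exact ⟨i + 1, hC i ▸ hincl (C i) (F i) (hi (Finset.mem_singleton_self v))⟩
  · exact hC i ▸ hbdry (C i) (F i)

theorem IsBoundedExhaustion.eventually_subset (hC : IsBoundedExhaustion G d C) {F : Set V}
    (hF : F.Finite) : ∀ᶠ i in Filter.atTop, F ⊆ C i :=
  (Filter.eventually_all_finite hF).2 fun v _ =>
    let ⟨i, hi⟩ := hC.exists_mem v
    Filter.eventually_atTop.2 ⟨i, fun _ hij => hC.monotone hij hi⟩

theorem exists_injOn_powerset {B : Set V} (hB : B.encard ≤ d) :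
    ∃ code : Set V → Set (Fin d), Set.InjOn code (𝒫 B) := by
  obtain ⟨e⟩ : Nonempty (B ↪ Fin d) := by
    have := (Set.finite_of_encard_le_coe hB).fintype
    refine Function.Embedding.nonempty_of_card_le ?_
    rw [← Set.toFinset_card, Fintype.card_fin]
    rwa [Set.encard_eq_coe_toFinset_card, Nat.cast_le] at hB
  refine ⟨fun S => e '' (Subtype.val ⁻¹' S), fun S hS T hT h => ?_⟩
  have hpre := e.injective.image_injective h
  rwa [Subtype.preimage_val_eq_preimage_val_iff, Set.inter_eq_right.2 hS,
    Set.inter_eq_right.2 hT] at hpre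

theorem crossingPattern_arc_mem (C : Set V) (c : Copy (multiRay ι) G) :
    crossingPattern C (Arc c) ∈
      𝒫 (outBoundary C G.Adj) ×ˢ 𝒫 (outBoundary C G.Adj) :=
  ⟨fun _ ⟨hv, u, hu, huv⟩ => ⟨hv, u, hu, huv.adj⟩,
    fun _ ⟨hv, u, hu, huv⟩ => ⟨hv, u, hu, Arc.adj huv |>.symm⟩⟩

theorem exists_eventually_hyperfilter_eq [Finite κ] (f : ℕ → κ) :
    ∃ p, ∀ᶠ i in (Filter.hyperfilter ℕ : Filter ℕ), f i = p := by
  obtain ⟨p, hp⟩ := ((Filter.hyperfilter ℕ).map f).eq_pure_of_finite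
  have hmem : {p} ∈ (Filter.hyperfilter ℕ).map f := hp ▸ Ultrafilter.mem_pure.2 rfl
  exact ⟨p, hmem⟩

theorem exists_color_forall_exists_embedding [Finite κ] (color : (k : ℕ) → Fin k → κ) :
    ∃ p, ∀ c, ∃ (k : ℕ) (e : Fin c ↪ Fin k), ∀ x, color k (e x) = p := by
  classical
  cases nonempty_fintype κ
  by_contra! h
  choose c hc using h
  have hlt (p : κ) : Finset.card {x : Fin (∑ p, c p) | color _ x = p} < c p := by
    by_contra! hle
    obtain ⟨e⟩ := Function.Embedding.nonempty_of_card_le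
      (α := Fin (c p)) (β := ({x | color _ x = p} : Finset (Fin (∑ p, c p))))
      (by simpa only [Fintype.card_fin, Fintype.card_coe])
    obtain ⟨x, hx⟩ := hc p _ (e.trans (Function.Embedding.subtype _))
    exact hx (Finset.mem_filter.1 (e x).2).2
  have hcard := Finset.card_eq_sum_card_fiberwise
    (f := color (∑ p, c p)) (s := Finset.univ) (t := Finset.univ) fun _ _ => Finset.mem_univ _
  have hsum := Finset.sum_lt_sum_of_nonempty ⟨color 1 0, Finset.mem_univ _⟩ fun p _ => hlt p
  rw [Finset.card_fin] at hcard
  exact hsum.ne hcard.symm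

/-- The crossing patterns at `C i` are coded by pairs of subsets of `Fin d`. The code of each copy
is constant along a nonprincipal ultrafilter on the indices `i`, and pigeonhole on these finitely
many limit codes selects the subfamilies. -/
theorem IsBoundedExhaustion.exists_subfamilies (hC : IsBoundedExhaustion G d C)
    (hG : HasArbitrarilyManyEdgeDisjoint G (multiRay ι)) :
    ∃ U : (c : ℕ) → Fin c → Copy (multiRay ι) G, (∀ c, EdgeDisjointCopies (U c)) ∧
      ∀ {c c'} x x', ∀ᶠ i in (Filter.hyperfilter ℕ : Filter ℕ),
        crossingPattern (C i) (Arc (U c x)) = crossingPattern (C i) (Arc (U c' x')) := by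
  choose T hT using fun k => hasEdgeDisjointFamily_iff_exists_copies.1 (hG k)
  choose code hcode using fun i => exists_injOn_powerset (hC.encard_le i)
  choose lim hlim using fun c : Copy (multiRay ι) G => exists_eventually_hyperfilter_eq fun i =>
    Prod.map (code i) (code i) (crossingPattern (C i) (Arc c))
  obtain ⟨p, hp⟩ := exists_color_forall_exists_embedding fun k x => lim (T k x)
  choose k e he using hp
  refine ⟨fun c x => T (k c) (e c x), fun c x y hxy => hT (k c) ((e c).injective.ne hxy),
    fun {c c'} x x' => ?_⟩
  filter_upwards [hlim (T (k c) (e c x)), hlim (T (k c') (e c' x'))] with i hi hi'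
  refine (hcode i).prodMap (hcode i) (crossingPattern_arc_mem _ _) (crossingPattern_arc_mem _ _) ?_
  exact (hi.trans (he c x)).trans (hi'.trans (he c' x')).symm

theorem crossingPattern_congr {C : Set V} {D D' : V → V → Prop}
    (h : ∀ u v, u ∉ C ∨ v ∉ C → (D u v ↔ D' u v)) :
    crossingPattern C D = crossingPattern C D' := by
  refine Prod.ext (Set.ext fun v => and_congr_right fun hv => ?_)
    (Set.ext fun v => and_congr_right fun hv => ?_)
  · exact exists_congr fun u => and_congr_right fun _ => h u v (.inr hv)
  · exact exists_congr fun u => and_congr_right fun _ => h v u (.inl hv)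

theorem crossingPattern_arc_comp_multiRayShift {C : Set V} {c : Copy (multiRay ι) G} {m : ℕ}
    (h : ∀ i, ∀ n ≤ m, c (i, n) ∈ C) :
    crossingPattern C (Arc (c.comp (multiRayShift ι m))) = crossingPattern C (Arc c) := by
  refine crossingPattern_congr fun u v huv => ⟨?_, ?_⟩
  · rintro ⟨i, n, rfl, rfl⟩
    exact ⟨i, n + m, rfl, by simp [add_right_comm]⟩
  · rintro ⟨i, n, rfl, rfl⟩
    have hmn : m ≤ n := by
      by_contra! hlt
      exact huv.elim (fun hu => hu (h i n hlt.le)) fun hv => hv (h i (n + 1) hlt)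
    obtain ⟨k, rfl⟩ := Nat.exists_eq_add_of_le' hmn
    exact ⟨i, k, rfl, by simp [add_right_comm]⟩

theorem IsBoundedExhaustion.exists_tail [Finite ι] (hC : IsBoundedExhaustion G d C)
    (c : Copy (multiRay ι) G) (i : ℕ) :
    ∃ Z : Copy (multiRay ι) G, copyEdges Z ⊆ copyEdges c ∧ (∀ p, Z p ∉ C i) ∧
      ∀ᶠ j in Filter.atTop, (∀ k, Z (k, 0) ∈ C j) ∧
        crossingPattern (C j) (Arc Z) = crossingPattern (C j) (Arc c) := by
  obtain ⟨m, hm⟩ := exists_multiRayShift_notMem c (C i).finite_toSet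
  refine ⟨c.comp (multiRayShift ι m), copyEdges_comp_subset _ _, hm, ?_⟩
  have hhead : (c '' (Set.univ ×ˢ {n | n ≤ m})).Finite :=
    (Set.finite_univ.prod (Set.finite_le_nat m)).image c
  filter_upwards [hC.eventually_subset hhead] with j hj
  have hmem (k : ι) (n : ℕ) (hn : n ≤ m) : c (k, n) ∈ C j := hj ⟨(k, n), ⟨trivial, hn⟩, rfl⟩
  exact ⟨fun k => hmem k (0 + m) (zero_add m).le, crossingPattern_arc_comp_multiRayShift hmem⟩

theorem IsBoundedExhaustion.exists_stage [Finite ι] (hC : IsBoundedExhaustion G d C)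
    {U : (c : ℕ) → Fin c → Copy (multiRay ι) G}
    (hU : ∀ {c c'} x x', ∀ᶠ i in (Filter.hyperfilter ℕ : Filter ℕ),
      crossingPattern (C i) (Arc (U c x)) = crossingPattern (C i) (Arc (U c' x')))
    (n i : ℕ) :
    ∃ j > i, ∃ Z : Copy (multiRay ι) G, copyEdges Z ⊆ copyEdges (U (n + 1) (Fin.last n)) ∧
      (∀ p, Z p ∉ C i) ∧ (∀ k, Z (k, 0) ∈ C j) ∧
      crossingPattern (C j) (Arc Z) = crossingPattern (C j) (Arc (U (n + 1) (Fin.last n))) ∧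
      ∀ x, crossingPattern (C j) (Arc (U (n + 1) x)) =
        crossingPattern (C j) (Arc (U (n + 2) x.castSucc)) := by
  obtain ⟨Z, hsub, hnotMem, htail⟩ := hC.exists_tail (U (n + 1) (Fin.last n)) i
  obtain ⟨j, ⟨⟨hstart, hZ⟩, hij⟩, hj⟩ :=
    (((htail.and (Filter.eventually_gt_atTop i)).filter_mono Nat.hyperfilter_le_atTop).and
      (Filter.eventually_all.2 fun x => hU (c := n + 1) (c' := n + 2) x x.castSucc)).exists
  exact ⟨j, hij, Z, hsub, hnotMem, hstart, hZ, hj⟩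

theorem IsBoundedExhaustion.exists_isStrandSystem [Finite ι] (hC : IsBoundedExhaustion G d C)
    (hG : HasArbitrarilyManyEdgeDisjoint G (multiRay ι)) :
    ∃ (a : ℕ → ℕ) (Y : ℕ → ℕ → Copy (multiRay ι) G), StrictMono a ∧
      IsStrandSystem (fun c => (C (a c) : Set V)) Y := by
  obtain ⟨U, hdisj, hU⟩ := hC.exists_subfamilies hG
  choose next hgt Z hsub hnotMem hstart hZ hnext using hC.exists_stage hU
  obtain ⟨a, ha⟩ : ∃ a : ℕ → ℕ, ∀ n, a (n + 1) = next n (a n) :=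
    ⟨Nat.rec 0 next, fun _ => rfl⟩
  let Y (n c : ℕ) : Copy (multiRay ι) G := if h : n + 1 < c then U c ⟨n, by omega⟩ else Z n (a n)
  have hYlast (n : ℕ) : Y n (n + 1) = Z n (a n) := dif_neg (lt_irrefl _)
  have hYlater {n c : ℕ} (h : n + 1 < c) : Y n c = U c ⟨n, by omega⟩ := dif_pos h
  have hYsub {n c : ℕ} (h : n < c) : copyEdges (Y n c) ⊆ copyEdges (U c ⟨n, h⟩) := by
    obtain rfl | hlt := eq_or_lt_of_le (Nat.succ_le_of_lt h)
    · exact hYlast n ▸ hsub n (a n)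
    · rw [hYlater hlt]
  have hYpattern {n c : ℕ} (h : n < c) : crossingPattern (C (a c)) (Arc (Y n c)) =
      crossingPattern (C (a c)) (Arc (U c ⟨n, h⟩)) := by
    obtain rfl | hlt := eq_or_lt_of_le (Nat.succ_le_of_lt h)
    · exact hYlast n ▸ ha n ▸ hZ n (a n)
    · rw [hYlater hlt]
  refine ⟨a, Y, strictMono_nat_of_lt_succ fun n => ha n ▸ hgt n (a n), ?_, ?_, ?_, ?_⟩
  · intro m n c hm hn hmn
    exact (hdisj c fun h => hmn (Fin.mk.inj_iff.1 h)).mono (hYsub hm) (hYsub hn)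
  · intro n c h
    obtain ⟨k, rfl⟩ := Nat.exists_eq_add_one_of_ne_zero (Nat.ne_zero_of_lt h)
    rw [hYpattern h, hYlater (Nat.succ_lt_succ h), ha]
    exact hnext k (a k) ⟨n, h⟩
  · exact fun n p => hYlast n ▸ hnotMem n (a n) p
  · exact fun n k => hYlast n ▸ ha n ▸ hstart n (a n) k

theorem IsBoundedExhaustion.hasEdgeDisjointFamily [Finite ι] (hC : IsBoundedExhaustion G d C)
    (hG : HasArbitrarilyManyEdgeDisjoint G (multiRay ι)) :
    HasEdgeDisjointFamily ℕ G (multiRay ι) := by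
  obtain ⟨a, Y, ha, hY⟩ := hC.exists_isStrandSystem hG
  refine hY.hasEdgeDisjointFamily (fun m n hmn => hC.monotone (ha.monotone hmn)) (fun v => ?_)
    fun c => (hC.outBoundary_subset (a c)).trans (hC.monotone (ha c.lt_succ_self))
  obtain ⟨i, hi⟩ := hC.exists_mem v
  exact ⟨i, hC.monotone (ha.le_apply (x := i)) hi⟩

end BoundedBoundary

theorem isEdgeUbiquitous_multiRay_of_finite (ι : Type*) [Finite ι] :
    IsEdgeUbiquitous.{u} (multiRay ι) := by
  refine isEdgeUbiquitous_of_countable_locallyFinite finite_neighborSet_multiRay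
    (hasCopiesOffFiniteSets_multiRay ι) fun V _ G hfin hG => ?_
  rcases exists_injective_avoiding_or_outBoundary_le hfin with
    ⟨I, f, hI, hf, hadj, hfI⟩ | ⟨d, hd⟩
  · exact hasEdgeDisjointFamily_of_injective_avoiding ι hI hf hadj hfI
  · obtain ⟨C, hC⟩ := exists_isBoundedExhaustion hd
    exact hC.hasEdgeDisjointFamily hG

theorem isEdgeUbiquitous_multiRay_of_infinite (ι : Type*) [Infinite ι] :
    IsEdgeUbiquitous.{u} (multiRay ι) := by
  intro V G hG
  obtain ⟨c, -⟩ := hasEdgeDisjointFamily_iff_exists_copies.1 (hG 1)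
  obtain ⟨e⟩ : Nonempty (ℕ × ι ↪ ι) := Cardinal.lift_mk_le'.1 (by simp)
  exact (hasEdgeDisjointFamily_multiRay_prod ℕ ι).map ((c 0).comp (multiRayReindex e))

theorem mainTheorem10_general (ι : Type w) : IsEdgeUbiquitous.{u} (multiRay ι) := by
  rcases finite_or_infinite ι
  · exact isEdgeUbiquitous_multiRay_of_finite ι
  · exact isEdgeUbiquitous_multiRay_of_infinite ι

theorem mainTheorem10 : IsEdgeUbiquitous.{u} twoRayGraph :=
  nonempty_multiRay_bool_iso_twoRayGraph.elim (mainTheorem10_general Bool).of_iso
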